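/- Let $N$ be a lattice of rank $d$, $N_{\mathbf R}=N\otimes\mathbf R$, $M_{\mathbf R}$ the space of linear functions on $N_{\mathbf R}$, and let $\Sigma$ be a complete fan of regular cones in $N_{\mathbf R}$: a finite set of cones, each generated by a subset of some $\mathbf Z$-basis of $N$ (its generators), closed under taking faces, such that any two cones intersect in a common face and the cones cover $N_{\mathbf R}$. Let $G(\Sigma)=\{v_1,\dots,v_n\}$ be the set of generators of the one-dimensional cones, and let $z_i$ be the variable of $\mathbf C[z]=\mathbf C[z_1,\dots,z_n]$ attached to $v_i$. A subset $\mathcal P\subset G(\Sigma)$ is a primitive collection if it is not the set of generators of a cone of $\Sigma$, but every proper subset of it is. Let $PL(\Sigma)$ be the space of continuous functions $N_{\mathbf R}\to\mathbf R$ that are linear on every cone of $\Sigma$, and let $K(\Sigma)\subset PL(\Sigma)/M_{\mathbf R}$ be the Kähler cone of the toric manifold $\mathbf P_\Sigma$: the set of classes of all $\psi\in PL(\Sigma)$ with $\psi(x)+\psi(y)\ge\psi(x+y)$ for all $x,y$. Such a $\psi$ is a strictly convex support function if it is given by different linear functions on any two different $d$-dimensional cones. Let $\varphi$ be a continuous function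 $N_{\mathbf R}\to\mathbf C$ that is ($\mathbf R$-)linear on every cone of $\Sigma$. Let $Q_\varphi(\Sigma)\subset\mathbf C[z]$ be the ideal generated by all binomials $$\exp\Big(\sum_i a_i\varphi(v_i)\Big)\prod_i z_i^{a_i}-\exp\Big(\sum_i b_i\varphi(v_i)\Big)\prod_i z_i^{b_i},\qquad \sum_i a_iv_i=\sum_i b_iv_i,\quad a_i,b_i\in\mathbf Z_{\ge0}.$$ For a primitive collection $\mathcal P=\{v_{i_1},\dots,v_{i_k}\}$ let $v_{j_1},\dots,v_{j_l}$ be the generators of the minimal cone of $\Sigma$ containing $v_{\mathcal P}=v_{i_1}+\dots+v_{i_k}$, write $v_{\mathcal P}=c_1v_{j_1}+\dots+c_lv_{j_l}$ with positive integers $c_1,\dots,c_l$, and put $$B_\varphi(\mathcal P)=z_{i_1}\cdots z_{i_k}-E_\varphi(\mathcal P)\,z_{j_1}^{c_1}\cdots z_{j_l}^{c_l},\qquad E_\varphi(\mathcal P)=\exp\big(\varphi(v_{\mathcal P})-\varphi(v_{i_1})-\dots-\varphi(v_{i_k})\big).$$ Let $SR(\Sigma)$ be the Stanley–Reisner ideal,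 generated by the monomials $\prod_{v_i\in\mathcal P}z_i$ for all primitive collections $\mathcal P$. For a weight vector $\omega\in\mathbf R^n$, the initial form $\mathrm{in}_\omega(f)$ of a polynomial $f$ is the sum of its terms of maximal $\omega$-weight, and the initial ideal $\mathrm{in}_\omega(I)$ of an ideal $I$ is generated by the initial forms of all elements of $I$. A set $S\subset I$ is a Gröbner basis of $I$ relative to $\omega$ if the initial forms of its elements generate $\mathrm{in}_\omega(I)$; it is reduced if the initial form of every $g\in S$ is a monomial with coefficient $1$ that divides no monomial occurring in an element of $S$, other than its own occurrence as the initial monomial of $g$. **Theorem.** Assume that $K(\Sigma)$ has non-empty interior in $PL(\Sigma)/M_{\mathbf R}$ (i.e. $\mathbf P_\Sigma$ is projective). Then there are only finitely many primitive collections, and the ideal $Q_\varphi(\Sigma)$ is generated by the binomials $B_\varphi(\mathcal P)$, where $\mathcal P$ runs over all primitive collections. Moreover, strictly convex support functions for $\Sigma$ exist, and for every strictly convex support function $\psi$, with weight vector $\omega=(\psi(v_1),\dots,\psi(v_n))$, the binomials $B_\varphi(\mathcal P)$ form a reduced Gröbner basis of $Q_\varphi(\Sigma)$ relative to $\omega$,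 and $\mathrm{in}_\omega Q_\varphi(\Sigma)=SR(\Sigma)$. -/

import Mathlib

noncomputable section

namespace BatyrevQuantum

/-! ### Regular cones and complete fans

`E` is the real vector space `N_ℝ` and `L ⊆ E` is the full-rank lattice `N`. -/

section Cones

variable {E : Type*} [NormedAddCommGroup E] [NormedSpace ℝ E]

/-- `s` is a subset of some `ℤ`-basis of the lattice `L`. -/
def IsPartOfBasis (L : Submodule ℤ E) (s : Set E) : Prop :=
  ∃ b : Module.Basis (Fin (Module.finrank ℤ L)) ℤ L, s ⊆ Set.range fun i => (b i : E)

/-- `s` is the set of integral generators of the regular cone `σ`: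
`s` is part of a `ℤ`-basis of `L`, and `σ` consists of the non-negative real combinations of `s`.
The number of elements of `s` is the dimension of `σ`. -/
def IsGenerators (L : Submodule ℤ E) (s : Set E) (σ : PointedCone ℝ E) : Prop :=
  IsPartOfBasis L s ∧ σ = PointedCone.hull ℝ s

/-- `σ` is a regular cone. -/
def IsRegularCone (L : Submodule ℤ E) (σ : PointedCone ℝ E) : Prop :=
  ∃ s, IsGenerators L s σ

/-- The regular cone `τ` is a face of the regular cone `σ`. -/
def IsFace (L : Submodule ℤ E) (τ σ : PointedCone ℝ E) : Prop :=
  ∃ t s, IsGenerators L t τ ∧ IsGenerators L s σ ∧ t ⊆ s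

/-- A complete fan of regular cones with respect to the lattice `L`. -/
structure CompleteRegularFan (L : Submodule ℤ E) where
  cones : Set (PointedCone ℝ E)
  finite_cones : cones.Finite
  regular : ∀ σ ∈ cones, IsRegularCone L σ
  face_mem : ∀ σ ∈ cones, ∀ τ, IsFace L τ σ → τ ∈ cones
  inter_face_left : ∀ σ ∈ cones, ∀ σ' ∈ cones, IsFace L (σ ⊓ σ') σ
  inter_face_right : ∀ σ ∈ cones, ∀ σ' ∈ cones, IsFace L (σ ⊓ σ') σ'
  complete : ∀ x : E, ∃ σ ∈ cones, x ∈ σ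

end Cones

namespace CompleteRegularFan

variable {E : Type*} [NormedAddCommGroup E] [NormedSpace ℝ E] {L : Submodule ℤ E}
  (F : CompleteRegularFan L)

/-- `G(Σ)`: the set of generators of the one-dimensional cones of the fan. -/
def generators : Set E := {v | ∃ σ ∈ F.cones, IsGenerators L {v} σ}

/-- The type of generators of one-dimensional cones; it indexes the variables `z_i`. -/
abbrev Gen : Type _ := ↥F.generators

/-- The set `P` of vectors is the set of generators of a cone of the fan. -/
def Spans (P : Finset F.Gen) : Prop :=
  ∃ σ ∈ F.cones, IsGenerators L ((fun v : F.Gen => (v : E)) '' (P : Set F.Gen)) σ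

/-- Primitive collections: `P` does not generate a cone of the fan, but all its proper subsets
do. -/
def IsPrimitiveCollection (P : Finset F.Gen) : Prop :=
  ¬ F.Spans P ∧ ∀ Q, Q ⊂ P → F.Spans Q

/-! ### Piecewise linear functions and the Kähler cone -/

/-- `V`-valued piecewise linear functions: continuous functions `N_ℝ → V` that are linear on every
cone of the fan. `PL(Σ)` is the case `V = ℝ`, and its complexification is the case `V = ℂ`. -/
def PL (V : Type*) [NormedAddCommGroup V] [NormedSpace ℝ V] : Submodule ℝ (E → V) where
  carrier := {φ | Continuous φ ∧
    ∀ σ ∈ F.cones, ∃ ℓ : E →ₗ[ℝ] V, Set.EqOn φ ℓ (σ : Set E)}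
  add_mem' := by
    rintro φ ψ ⟨hφ, hφ'⟩ ⟨hψ, hψ'⟩
    refine ⟨hφ.add hψ, fun σ hσ => ?_⟩
    obtain ⟨ℓ, hℓ⟩ := hφ' σ hσ
    obtain ⟨m, hm⟩ := hψ' σ hσ
    exact ⟨ℓ + m, fun x hx => by simp [hℓ hx, hm hx]⟩
  zero_mem' := ⟨continuous_const, fun _ _ => ⟨0, fun _ _ => rfl⟩⟩
  smul_mem' := by
    rintro c φ ⟨hφ, hφ'⟩
    refine ⟨hφ.const_smul c, fun σ hσ => ?_⟩
    obtain ⟨ℓ, hℓ⟩ := hφ' σ hσ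
    exact ⟨c • ℓ, fun x hx => by simp [hℓ hx]⟩

/-- The subspace `M_ℝ` of globally linear functions in `PL(Σ)`. -/
def globallyLinear : Submodule ℝ (F.PL ℝ) :=
  (LinearMap.range (LinearMap.ltoFun ℝ E ℝ ℝ)).comap (F.PL ℝ).subtype

/-- The space `PL(Σ) / M_ℝ`. Its topology is the quotient topology of the topology of pointwise
convergence on `PL(Σ)`, that is, the canonical topology of a finite-dimensional real vector
space. -/
abbrev PLModLinear : Type _ := F.PL ℝ ⧸ F.globallyLinear

/-- Upper convexity in the convention `φ(x) + φ(y) ≥ φ(x + y)`. -/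
def IsUpperConvex (φ : F.PL ℝ) : Prop :=
  ∀ x y : E, (φ : E → ℝ) (x + y) ≤ (φ : E → ℝ) x + (φ : E → ℝ) y

/-- The closed Kähler cone `K(Σ)` in `PL(Σ) / M_ℝ`. -/
def kahlerCone : Set F.PLModLinear :=
  F.globallyLinear.mkQ '' {φ | F.IsUpperConvex φ}

/-- `σ` is a cone of the fan of the maximal dimension `d = dim N_ℝ`. -/
def IsMaximalCone (σ : PointedCone ℝ E) : Prop :=
  σ ∈ F.cones ∧ ∃ s, IsGenerators L s σ ∧ s.ncard = Module.finrank ℝ E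

/-- Strictly convex support functions: upper convex, and given by different linear functions on
different cones of the maximal dimension. -/
def IsStrictlyConvexSupport (φ : F.PL ℝ) : Prop :=
  F.IsUpperConvex φ ∧
    ∀ σ₁ σ₂, F.IsMaximalCone σ₁ → F.IsMaximalCone σ₂ → σ₁ ≠ σ₂ →
      ∀ ℓ₁ ℓ₂ : E →ₗ[ℝ] ℝ, Set.EqOn (φ : E → ℝ) ℓ₁ (σ₁ : Set E) →
        Set.EqOn (φ : E → ℝ) ℓ₂ (σ₂ : Set E) → ℓ₁ ≠ ℓ₂

/-! ### The expression of a lattice vector through the generators of its minimal cone -/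

/-- The support of `c` is the set of generators of the minimal cone of the fan that contains `x`,
and `x = ∑ c_j v_j`. -/
def IsMinimalExpression (x : E) (c : F.Gen →₀ ℕ) : Prop :=
  (∃ σ, IsLeast {τ | τ ∈ F.cones ∧ x ∈ τ} σ ∧
    IsGenerators L ((fun v : F.Gen => (v : E)) '' (c.support : Set F.Gen)) σ) ∧
  Finsupp.weight (fun v : F.Gen => (v : E)) c = x

theorem exists_isLeast (x : E) : ∃ σ, IsLeast {τ | τ ∈ F.cones ∧ x ∈ τ} σ := by
  have hfin : {τ | τ ∈ F.cones ∧ x ∈ τ}.Finite := F.finite_cones.subset fun _ h => h.1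
  obtain ⟨σ₀, h₀, hx₀⟩ := F.complete x
  obtain ⟨σ, hσ⟩ := hfin.exists_minimal ⟨σ₀, h₀, hx₀⟩
  refine ⟨σ, hσ.prop, fun τ hτ => ?_⟩
  have hm : σ ⊓ τ ∈ {τ | τ ∈ F.cones ∧ x ∈ τ} :=
    ⟨F.face_mem σ hσ.prop.1 _ (F.inter_face_left σ hσ.prop.1 τ hτ.1), hσ.prop.2, hτ.2⟩
  exact (hσ.le_of_le hm inf_le_left).trans inf_le_right

theorem mem_hull_image_iff {ι : Type*} [Finite ι] (b : Module.Basis ι ℝ E) (T : Set ι) (x : E) :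
    x ∈ PointedCone.hull ℝ (b '' T) ↔ (∀ i, 0 ≤ b.repr x i) ∧ ∀ i ∉ T, b.repr x i = 0 := by
  classical
  have := Fintype.ofFinite ι
  constructor
  · intro hx
    induction hx using Submodule.span_induction with
    | mem x hx =>
      obtain ⟨i, hi, rfl⟩ := hx
      refine ⟨fun j => ?_, fun j hj => ?_⟩
      · rw [b.repr_self, Finsupp.single_apply]; split_ifs <;> simp
      · rw [b.repr_self, Finsupp.single_apply, if_neg]
        rintro rfl; exact hj hi
    | zero => simp
    | add x y _ _ hx hy =>
      refine ⟨fun i => ?_, fun i hi => ?_⟩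
      · simpa using add_nonneg (hx.1 i) (hy.1 i)
      · simp [hx.2 i hi, hy.2 i hi]
    | smul c x _ hx =>
      have hc : ∀ i, b.repr (c • x) i = (c : ℝ) * b.repr x i := fun i => by
        have h : c • x = (c : ℝ) • x := rfl
        rw [h, map_smul, Finsupp.smul_apply, smul_eq_mul]
      refine ⟨fun i => ?_, fun i hi => ?_⟩
      · rw [hc]; exact mul_nonneg c.2 (hx.1 i)
      · rw [hc, hx.2 i hi, mul_zero]
  · rintro ⟨h0, hT⟩
    rw [← b.sum_repr x]
    refine Submodule.sum_mem _ fun i _ => ?_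
    by_cases hi : i ∈ T
    · exact PointedCone.smul_mem _ (h0 i) (Submodule.subset_span ⟨i, hi, rfl⟩)
    · rw [hT i hi, zero_smul]; exact Submodule.zero_mem _

theorem exists_isMinimalExpression [FiniteDimensional ℝ E] [DiscreteTopology L] [IsZLattice ℝ L]
    {x : E} (hx : x ∈ L) : ∃ c, F.IsMinimalExpression x c := by
  classical
  obtain ⟨σ, hσ⟩ := F.exists_isLeast x
  obtain ⟨s, ⟨b, hb⟩, hs⟩ := F.regular σ hσ.1.1
  set B := b.ofZLatticeBasis ℝ L with hB
  have hBb : ∀ i, B i = (b i : E) := fun i => by simp [hB]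
  set T : Set (Fin (Module.finrank ℤ L)) := {i | (b i : E) ∈ s} with hT
  have hgen : ∀ T' : Set (Fin (Module.finrank ℤ L)), T' ⊆ T →
      IsGenerators L (B '' T') (PointedCone.hull ℝ (B '' T')) ∧ B '' T' ⊆ s := by
    intro T' hT'
    have h2 : B '' T' ⊆ s := by rintro _ ⟨i, hi, rfl⟩; rw [hBb]; exact hT' hi
    exact ⟨⟨⟨b, h2.trans hb⟩, rfl⟩, h2⟩
  have hsT : s = B '' T := by
    refine Set.Subset.antisymm (fun v hv => ?_) (hgen T subset_rfl).2
    obtain ⟨i, rfl⟩ := hb hv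
    exact ⟨i, hv, hBb i⟩
  have hface : ∀ T' : Set (Fin (Module.finrank ℤ L)), T' ⊆ T →
      PointedCone.hull ℝ (B '' T') ∈ F.cones := fun T' hT' =>
    F.face_mem σ hσ.1.1 _ ⟨_, s, (hgen T' hT').1, ⟨⟨b, hb⟩, hs⟩, (hgen T' hT').2⟩
  have hxσ := hσ.1.2
  rw [hs, hsT, mem_hull_image_iff] at hxσ
  have hrepr : ∀ i, B.repr x i = (b.repr ⟨x, hx⟩ i : ℝ) := fun i =>
    b.ofZLatticeBasis_repr_apply ℝ L ⟨x, hx⟩ i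
  have hpos : ∀ i ∈ T, 0 < b.repr ⟨x, hx⟩ i := by
    intro i hi
    have h0 : (0 : ℝ) ≤ (b.repr ⟨x, hx⟩ i : ℝ) := by rw [← hrepr]; exact hxσ.1 i
    have h0' : 0 ≤ b.repr ⟨x, hx⟩ i := by exact_mod_cast h0
    refine lt_of_le_of_ne h0' fun h => ?_
    have hmem : x ∈ PointedCone.hull ℝ (B '' (T \ {i})) := by
      rw [mem_hull_image_iff]
      refine ⟨hxσ.1, fun j hj => ?_⟩
      by_cases hji : j = i
      · rw [hji, hrepr, ← h]; simp
      · exact hxσ.2 j fun hjT => hj ⟨hjT, hji⟩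
    have hle := hσ.2 ⟨hface _ Set.sdiff_subset, hmem⟩
    have hi' : B i ∈ σ := by
      rw [hs, hsT]; exact Submodule.subset_span ⟨i, hi, rfl⟩
    have h1 := ((mem_hull_image_iff B _ _).1 (hle hi')).2 i (by simp)
    simp at h1
  have hG : ∀ i : T, (b i : E) ∈ F.generators := fun i =>
    ⟨_, hface {i.1} (by simp), by
      have := (hgen {i.1} (by simp)).1
      simpa [hBb] using this⟩
  let e : T ↪ F.Gen := ⟨fun i => ⟨b i, hG i⟩, fun i j hij => by
    have h : (b i : E) = b j := congrArg (fun g : F.Gen => (g : E)) hij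
    exact Subtype.ext (b.injective (Subtype.ext h))⟩
  let f : T →₀ ℕ := Finsupp.equivFunOnFinite.symm fun i => (b.repr ⟨x, hx⟩ i).toNat
  have hfs : ∀ i : T, f i ≠ 0 := fun i => by
    have := hpos i i.2
    simp only [f, Finsupp.equivFunOnFinite_symm_apply_apply]
    omega
  refine ⟨f.embDomain e, ⟨σ, hσ, ?_⟩, ?_⟩
  · have : (fun v : F.Gen => (v : E)) '' ((f.embDomain e).support : Set F.Gen) = s := by
      rw [hsT]
      ext v
      simp only [Finsupp.support_embDomain, Finset.coe_map, Set.mem_image, Finset.mem_coe,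
        Finsupp.mem_support_iff]
      constructor
      · rintro ⟨_, ⟨i, _, rfl⟩, rfl⟩
        exact ⟨i, i.2, hBb i⟩
      · rintro ⟨i, hi, rfl⟩
        exact ⟨_, ⟨⟨i, hi⟩, hfs _, rfl⟩, (hBb i).symm⟩
    rw [this]
    exact ⟨⟨b, hb⟩, hs⟩
  · rw [Finsupp.weight_apply, Finsupp.sum_embDomain, Finsupp.sum_fintype _ _ (by simp)]
    conv_rhs => rw [← B.sum_repr x]
    rw [← Finset.sum_subset (Finset.subset_univ (Finset.univ.filter (· ∈ T)))
      (fun i _ hi => by rw [hxσ.2 i (by simpa using hi), zero_smul])]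
    rw [← Finset.sum_subtype_eq_sum_filter, Finset.subtype_univ]
    refine Finset.sum_congr rfl fun i _ => ?_
    have h := hpos i i.2
    simp only [f, e, Finsupp.equivFunOnFinite_symm_apply_apply]
    rw [hBb, hrepr, ← Nat.cast_smul_eq_nsmul ℝ]
    congr 1
    have h2 : (((b.repr ⟨x, hx⟩ i).toNat : ℤ) : ℝ) = (b.repr ⟨x, hx⟩ i : ℝ) := by
      rw [Int.toNat_of_nonneg h.le]
    exact_mod_cast h2

theorem sum_mem_lattice (P : Finset F.Gen) : ∑ v ∈ P, (v : E) ∈ L := by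
  refine Submodule.sum_mem _ fun v _ => ?_
  obtain ⟨σ, _, ⟨b, hb⟩, _⟩ := v.2
  obtain ⟨i, hi⟩ := hb rfl
  have hi' : (b i : E) = v := hi
  rw [← hi']
  exact (b i).2

/-! ### The ideals and the binomials of primitive collections -/

/-- The Stanley–Reisner ideal: generated by the squarefree monomials of the primitive
collections. -/
def stanleyReisner : Ideal (MvPolynomial F.Gen ℂ) :=
  Ideal.span ((fun P : Finset F.Gen => ∏ v ∈ P, MvPolynomial.X v) ''
    {P | F.IsPrimitiveCollection P})

/-- The ideal `Q_φ(Σ)`: generated by the binomials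
`exp(∑ a_i φ(v_i)) z^a - exp(∑ b_i φ(v_i)) z^b` for all relations `∑ a_i v_i = ∑ b_i v_i` with
non-negative integers `a_i`, `b_i`. -/
def quantumIdeal (φ : F.PL ℂ) : Ideal (MvPolynomial F.Gen ℂ) :=
  Ideal.span {p | ∃ a b : F.Gen →₀ ℕ,
    Finsupp.weight (fun v : F.Gen => (v : E)) a = Finsupp.weight (fun v : F.Gen => (v : E)) b ∧
    p = MvPolynomial.monomial a
          (Complex.exp (Finsupp.weight (fun v : F.Gen => (φ : E → ℂ) v) a))
      - MvPolynomial.monomial b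
          (Complex.exp (Finsupp.weight (fun v : F.Gen => (φ : E → ℂ) v) b))}

section Binomials

variable [FiniteDimensional ℝ E] [DiscreteTopology L] [IsZLattice ℝ L]

/-- The exponent vector `c` in the relation `∑_{v ∈ P} v = c_1 v_{j_1} + ⋯ + c_l v_{j_l}`, where
the `v_j` are the generators of the minimal cone that contains the left-hand side and all `c_j` are
positive. -/
def primitiveExponent (P : Finset F.Gen) : F.Gen →₀ ℕ :=
  (F.exists_isMinimalExpression (F.sum_mem_lattice P)).choose

theorem primitiveExponent_spec (P : Finset F.Gen) :
    F.IsMinimalExpression (∑ v ∈ P, (v : E)) (F.primitiveExponent P) :=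
  (F.exists_isMinimalExpression (F.sum_mem_lattice P)).choose_spec

/-- `E_φ(P) = exp(φ(∑_{v ∈ P} v) - ∑_{v ∈ P} φ(v))`. -/
def quantumFactor (φ : F.PL ℂ) (P : Finset F.Gen) : ℂ :=
  Complex.exp ((φ : E → ℂ) (∑ v ∈ P, (v : E)) - ∑ v ∈ P, (φ : E → ℂ) v)

/-- The binomial `B_φ(P) = ∏_{v ∈ P} z_v - E_φ(P) z^c`. -/
def binomial (φ : F.PL ℂ) (P : Finset F.Gen) : MvPolynomial F.Gen ℂ :=
  (∏ v ∈ P, MvPolynomial.X v) -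
    MvPolynomial.monomial (F.primitiveExponent P) (F.quantumFactor φ P)

/-- The set of all binomials `B_φ(P)`, where `P` runs over all primitive collections. -/
def primitiveBinomials (φ : F.PL ℂ) : Set (MvPolynomial F.Gen ℂ) :=
  F.binomial φ '' {P | F.IsPrimitiveCollection P}

end Binomials

end CompleteRegularFan

/-! ### Gröbner bases with respect to a weight vector -/

section Groebner

variable {κ : Type*}

/-- The initial form of `p` with respect to the weight vector `ω`: the sum of the terms of `p` of
the maximal `ω`-weight. -/
def initialForm (ω : κ → ℝ) (p : MvPolynomial κ ℂ) : MvPolynomial κ ℂ :=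
  open scoped Classical in
  ∑ a ∈ p.support with ∀ b ∈ p.support, Finsupp.weight ω b ≤ Finsupp.weight ω a,
    MvPolynomial.monomial a (p.coeff a)

/-- The initial ideal of `I` with respect to `ω`: generated by the initial forms of all elements
of `I`. -/
def initialIdeal (ω : κ → ℝ) (I : Ideal (MvPolynomial κ ℂ)) : Ideal (MvPolynomial κ ℂ) :=
  Ideal.span (initialForm ω '' (I : Set (MvPolynomial κ ℂ)))

/-- `S` is a Gröbner basis of the ideal `I` with respect to `ω`. -/
def IsGroebnerBasis (ω : κ → ℝ) (I : Ideal (MvPolynomial κ ℂ)) (S : Set (MvPolynomial κ ℂ)) :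
    Prop :=
  S ⊆ I ∧ Ideal.span (initialForm ω '' S) = initialIdeal ω I

/-- `S` is a reduced Gröbner basis of `I` with respect to `ω`: the initial form of every `g ∈ S` is
a monomial with coefficient `1`, and it divides no monomial that occurs in an element of `S`,
except that it occurs as the initial monomial of `g` itself. -/
def IsReducedGroebnerBasis (ω : κ → ℝ) (I : Ideal (MvPolynomial κ ℂ))
    (S : Set (MvPolynomial κ ℂ)) : Prop :=
  IsGroebnerBasis ω I S ∧
    ∀ g ∈ S, ∃ a : κ →₀ ℕ, initialForm ω g = MvPolynomial.monomial a 1 ∧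
      ∀ h ∈ S, ∀ m ∈ h.support, a ≤ m → h = g ∧ m = a

end Groebner

end BatyrevQuantum

end

namespace BatyrevQuantum

open Topology

/-! ### Regular cones and the uniqueness of their generators. -/

section Cones

variable {E : Type*} [NormedAddCommGroup E] {L : Submodule ℤ E}

/-! Grade monomials by `∑ a_i v_i` and call one standard if its variables lie in a common cone. Each
degree contains at most one standard monomial (`eq_of_weight_eq`). A strictly convex `ψ` gives a
standard monomial weight `ψ(degree)` and every other monomial strictly more (`map_weight_lt`).

Existence of normal forms: a nonstandard monomial is divisible by the monomial of a primitive
collection, and the corresponding binomial replaces it by one of the same degree and smaller weight.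
The drop is bounded below, so rewriting ends at the standard monomial (`exists_normalForm`).
Monomials of equal degree thus have the same normal form, which gives generation.

Initial ideal: the functional `degreeSum`, adding up the normalised coefficients in one degree,
kills the quantum ideal. A standard monomial of maximal weight in `f` would be the only term of `f`
in its degree, so its coefficient would vanish (`initialForm_mem`).

Existence of `ψ`: an interior class of the Kähler cone stays convex under small perturbations, which
fails if two maximal cones share a linear function (`exists_isStrictlyConvexSupport`). -/

theorem IsPartOfBasis.mono {s t : Set E} (hs : IsPartOfBasis L s) (h : t ⊆ s) :
    IsPartOfBasis L t := by
  obtain ⟨b, hb⟩ := hs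
  exact ⟨b, h.trans hb⟩

theorem IsPartOfBasis.finite {s : Set E} (hs : IsPartOfBasis L s) : s.Finite := by
  obtain ⟨b, hb⟩ := hs
  exact (Set.finite_range _).subset hb

variable [NormedSpace ℝ E]

theorem IsGenerators.subset {s : Set E} {σ : PointedCone ℝ E} (hs : IsGenerators L s σ) :
    s ⊆ (σ : Set E) := by
  rw [hs.2]
  exact Submodule.subset_span

theorem eqOn_hull {V : Type*} [AddCommGroup V] [Module ℝ V] {s : Set E} {ℓ ℓ' : E →ₗ[ℝ] V}
    (h : Set.EqOn ℓ ℓ' s) : Set.EqOn ℓ ℓ' (PointedCone.hull ℝ s : Set E) := by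
  intro x hx
  induction hx using Submodule.span_induction with
  | mem x hx => exact h hx
  | zero => simp
  | add x y _ _ hx hy => rw [map_add, map_add, hx, hy]
  | smul c x _ hx =>
    have hc : c • x = (c : ℝ) • x := rfl
    rw [hc, map_smul, map_smul, hx]

variable [FiniteDimensional ℝ E] [DiscreteTopology L] [IsZLattice ℝ L]

theorem IsPartOfBasis.exists_basis {s : Set E} (hs : IsPartOfBasis L s) :
    ∃ (B : Module.Basis (Fin (Module.finrank ℤ L)) ℝ E) (T : Set (Fin (Module.finrank ℤ L))),
      s = B '' T ∧ (∀ i, B i ∈ L) ∧ ∀ x ∈ L, ∀ i, ∃ n : ℤ, B.repr x i = n := by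
  obtain ⟨b, hb⟩ := hs
  have hB : ∀ i, b.ofZLatticeBasis ℝ L i = (b i : E) := fun i => by simp
  refine ⟨b.ofZLatticeBasis ℝ L, {i | (b i : E) ∈ s}, ?_, fun i => by rw [hB]; exact (b i).2,
    fun x hx i => ⟨_, b.ofZLatticeBasis_repr_apply ℝ L ⟨x, hx⟩ i⟩⟩
  ext v
  constructor
  · intro hv
    obtain ⟨i, rfl⟩ := hb hv
    exact ⟨i, hv, hB i⟩
  · rintro ⟨i, hi, rfl⟩
    rw [hB]
    exact hi

theorem IsPartOfBasis.exists_linearMap {V : Type*} [AddCommGroup V] [Module ℝ V] {s : Set E}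
    (hs : IsPartOfBasis L s) (f : E → V) : ∃ ℓ : E →ₗ[ℝ] V, Set.EqOn ℓ f s := by
  obtain ⟨B, T, rfl, -, -⟩ := hs.exists_basis
  refine ⟨B.constr ℝ fun i => f (B i), ?_⟩
  rintro _ ⟨i, _, rfl⟩
  rw [B.constr_basis]

/-- A generator `B i` spans an extremal ray: in its non-negative expansion over the `C j`, all terms
that occur must be multiples of `B i`. Integrality in both bases then makes the positive factor
equal to `1`. -/
theorem IsGenerators.subset_generators {s t : Set E} {σ : PointedCone ℝ E}
    (hs : IsGenerators L s σ) (ht : IsGenerators L t σ) : s ⊆ t := by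
  have hsσ := hs.subset
  have htσ := ht.subset
  obtain ⟨B, T, rfl, hBL, hBZ⟩ := hs.1.exists_basis
  obtain ⟨C, U, rfl, hCL, hCZ⟩ := ht.1.exists_basis
  rintro _ ⟨i, hi, rfl⟩
  have hv : B i ∈ PointedCone.hull ℝ (C '' U) := by rw [← ht.2]; exact hsσ ⟨i, hi, rfl⟩
  obtain ⟨hv0, hvU⟩ := (CompleteRegularFan.mem_hull_image_iff C U _).1 hv
  have hC : ∀ j ∈ U, ∀ k, 0 ≤ B.repr (C j) k := fun j hj =>
    ((CompleteRegularFan.mem_hull_image_iff B T _).1 (by rw [← hs.2]; exact htσ ⟨j, hj, rfl⟩)).1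
  obtain ⟨j, hj⟩ : ∃ j, C.repr (B i) j ≠ 0 := by
    by_contra! h
    exact B.ne_zero i (C.repr.map_eq_zero_iff.1 (Finsupp.ext h))
  have hjU : j ∈ U := by
    by_contra h
    exact hj (hvU j h)
  -- The `k`-th coordinate of `B i` is zero, yet it is a sum of non-negative terms, so each term
  -- vanishes.
  have hk : ∀ k, k ≠ i → B.repr (C j) k = 0 := by
    intro k hki
    have h1 : B.repr (B i) k = ∑ j, C.repr (B i) j * B.repr (C j) k := by
      conv_lhs => rw [← C.sum_repr (B i), map_sum, Finsupp.finsetSum_apply]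
      simp
    rw [B.repr_self, Finsupp.single_eq_of_ne hki, eq_comm, Finset.sum_eq_zero_iff_of_nonneg] at h1
    · exact (mul_eq_zero.1 (h1 j (Finset.mem_univ j))).resolve_left hj
    · intro j' _
      by_cases hj' : j' ∈ U
      · exact mul_nonneg (hv0 j') (hC j' hj' k)
      · rw [hvU j' hj', zero_mul]
  have hCj : C j = B.repr (C j) i • B i := by
    conv_lhs => rw [← B.sum_repr (C j)]
    exact Finset.sum_eq_single i (fun k _ hki => by rw [hk k hki, zero_smul]) (by simp)
  have h1 : (1 : ℝ) = B.repr (C j) i * C.repr (B i) j := by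
    have h2 : C.repr (C j) j = C.repr (B.repr (C j) i • B i) j := by rw [← hCj]
    simpa using h2
  obtain ⟨n, hn⟩ := hBZ _ (hCL j) i
  obtain ⟨m, hm⟩ := hCZ _ (hBL i) j
  have hn0 := hC j hjU i
  rw [hn] at hn0 h1 hCj
  rw [hm] at h1
  have hnm : n * m = 1 := by exact_mod_cast h1.symm
  have hn1 : n = 1 := Int.eq_one_of_mul_eq_one_right (by exact_mod_cast hn0) hnm
  rw [hn1, Int.cast_one, one_smul] at hCj
  exact ⟨j, hjU, hCj⟩

theorem IsGenerators.unique {s t : Set E} {σ : PointedCone ℝ E}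
    (hs : IsGenerators L s σ) (ht : IsGenerators L t σ) : s = t :=
  (hs.subset_generators ht).antisymm (ht.subset_generators hs)

end Cones

/-! ### Generating sets of cones and piecewise linear functions on the fan. -/

namespace CompleteRegularFan

variable {E : Type*} [NormedAddCommGroup E] [NormedSpace ℝ E] {L : Submodule ℤ E}
  (F : CompleteRegularFan L)

theorem hull_mem {σ : PointedCone ℝ E} (hσ : σ ∈ F.cones) {s t : Set E}
    (hs : IsGenerators L s σ) (hts : t ⊆ s) : PointedCone.hull ℝ t ∈ F.cones :=
  F.face_mem σ hσ _ ⟨t, s, ⟨hs.1.mono hts, rfl⟩, hs, hts⟩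

theorem inf_mem {σ τ : PointedCone ℝ E} (hσ : σ ∈ F.cones) (hτ : τ ∈ F.cones) :
    σ ⊓ τ ∈ F.cones :=
  F.face_mem σ hσ _ (F.inter_face_left σ hσ τ hτ)

theorem exists_isPrimitiveCollection_subset {P : Finset F.Gen} (hP : ¬ F.Spans P) :
    ∃ Q ⊆ P, F.IsPrimitiveCollection Q := by
  induction P using Finset.strongInduction with
  | H P ih =>
    by_cases h : ∀ Q, Q ⊂ P → F.Spans Q
    · exact ⟨P, subset_rfl, hP, h⟩
    · push Not at h
      obtain ⟨Q, hQP, hQ⟩ := h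
      obtain ⟨R, hRQ, hR⟩ := ih Q hQP hQ
      exact ⟨R, hRQ.trans hQP.subset, hR⟩

theorem IsMinimalExpression.spans {F : CompleteRegularFan L} {x : E} {c : F.Gen →₀ ℕ}
    (h : F.IsMinimalExpression x c) : F.Spans c.support := by
  obtain ⟨⟨σ, hσ, hg⟩, -⟩ := h
  exact ⟨σ, hσ.1.1, hg⟩

section Lattice

variable [FiniteDimensional ℝ E] [DiscreteTopology L] [IsZLattice ℝ L]

/-- A ray of the fan contained in `σ` equals its intersection with `σ`, hence is a face, and
uniqueness of generators puts its generator in `s`. -/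
theorem generators_eq {σ : PointedCone ℝ E} (hσ : σ ∈ F.cones) {s : Set E}
    (hs : IsGenerators L s σ) : s = {v | v ∈ F.generators ∧ v ∈ σ} := by
  ext v
  constructor
  · intro hv
    have h : {v} ⊆ s := Set.singleton_subset_iff.2 hv
    exact ⟨⟨_, F.hull_mem hσ hs h, hs.1.mono h, rfl⟩, hs.subset hv⟩
  · rintro ⟨⟨ρ, hρ, hv⟩, hvσ⟩
    have hle : ρ ≤ σ := by
      rw [hv.2]
      exact Submodule.span_le.2 (Set.singleton_subset_iff.2 hvσ)
    obtain ⟨t, s', ht, hs', hts⟩ := F.inter_face_right ρ hρ σ hσ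
    rw [inf_eq_left.2 hle] at ht
    rw [hs.unique hs', ← Set.singleton_subset_iff, hv.unique ht]
    exact hts

theorem isGenerators_of_mem {σ : PointedCone ℝ E} (hσ : σ ∈ F.cones) :
    IsGenerators L {v | v ∈ F.generators ∧ v ∈ σ} σ := by
  obtain ⟨s, hs⟩ := F.regular σ hσ
  rwa [← F.generators_eq hσ hs]

/-- Generators lying in one cone are among the generators of that cone, so they generate a face of
it. -/
theorem spans_iff (P : Finset F.Gen) : F.Spans P ↔ ∃ σ ∈ F.cones, ∀ v ∈ P, (v : E) ∈ σ := by
  constructor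
  · rintro ⟨σ, hσ, h⟩
    exact ⟨σ, hσ, fun v hv => h.subset ⟨v, hv, rfl⟩⟩
  · rintro ⟨σ, hσ, h⟩
    have hg := F.isGenerators_of_mem hσ
    have hsub : (fun v : F.Gen => (v : E)) '' (P : Set F.Gen) ⊆
        {v | v ∈ F.generators ∧ v ∈ σ} := by
      rintro _ ⟨v, hv, rfl⟩
      exact ⟨v.2, h v hv⟩
    exact ⟨_, F.hull_mem hσ hg hsub, hg.1.mono hsub, rfl⟩

theorem Spans.mono {F : CompleteRegularFan L} {P Q : Finset F.Gen} (hP : F.Spans P) (h : Q ⊆ P) :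
    F.Spans Q := by
  obtain ⟨σ, hσ, hPσ⟩ := (F.spans_iff P).1 hP
  exact (F.spans_iff Q).2 ⟨σ, hσ, fun v hv => hPσ v (h hv)⟩

theorem finite_generators : F.generators.Finite := by
  refine (F.finite_cones.biUnion fun σ hσ => (F.isGenerators_of_mem hσ).1.finite).subset ?_
  rintro v ⟨σ, hσ, hv⟩
  exact Set.mem_biUnion hσ ⟨⟨σ, hσ, hv⟩, hv.subset rfl⟩

instance finite_gen : Finite F.Gen := F.finite_generators.to_subtype

theorem finite_primitiveCollections : {P | F.IsPrimitiveCollection P}.Finite :=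
  Set.toFinite _

theorem isClosed_of_mem {σ : PointedCone ℝ E} (hσ : σ ∈ F.cones) : IsClosed (σ : Set E) := by
  obtain ⟨s, hs, rfl⟩ := F.regular σ hσ
  obtain ⟨B, T, rfl, -, -⟩ := hs.exists_basis
  have h : (PointedCone.hull ℝ (B '' T) : Set E) =
      (⋂ i, {x | 0 ≤ B.coord i x}) ∩ ⋂ i ∈ Tᶜ, {x | B.coord i x = 0} := by
    ext x
    simp [mem_hull_image_iff]
  rw [h]
  exact (isClosed_iInter fun i => isClosed_le continuous_const
    (LinearMap.continuous_of_finiteDimensional _)).inter (isClosed_biInter fun i _ =>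
      isClosed_eq (LinearMap.continuous_of_finiteDimensional _) continuous_const)

/-- Piecewise linear functions take arbitrary values on the generators. -/
theorem exists_PL_eq (f : E → ℝ) : ∃ χ : F.PL ℝ, ∀ v : F.Gen, (χ : E → ℝ) v = f v := by
  have h1 : ∀ σ : F.cones, ∃ ℓ : E →ₗ[ℝ] ℝ, ∀ v ∈ F.generators, v ∈ σ.1 → ℓ v = f v := fun σ => by
    obtain ⟨ℓ, hℓ⟩ := (F.isGenerators_of_mem σ.2).1.exists_linearMap f
    exact ⟨ℓ, fun v hv hvσ => hℓ ⟨hv, hvσ⟩⟩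
  choose ℓ hℓ using h1
  have h2 : ∀ x : E, ∃ σ : F.cones, x ∈ σ.1 := fun x => by
    obtain ⟨σ, hσ, hx⟩ := F.complete x
    exact ⟨⟨σ, hσ⟩, hx⟩
  choose c hc using h2
  -- The choice of cone is immaterial: two cones meet in a cone of the fan, on whose generators both
  -- linear functions take the values of `f`.
  have key : ∀ σ : F.cones, Set.EqOn (fun x => ℓ (c x) x) (ℓ σ) (σ.1 : Set E) := by
    intro σ x hx
    have hg := F.isGenerators_of_mem (F.inf_mem (c x).2 σ.2)
    have hmem : x ∈ (c x).1 ⊓ σ.1 := ⟨hc x, hx⟩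
    rw [hg.2] at hmem
    refine eqOn_hull ?_ hmem
    rintro v ⟨hv, hvc, hvσ⟩
    rw [hℓ _ v hv hvc, hℓ _ v hv hvσ]
  have : Finite F.cones := F.finite_cones.to_subtype
  refine ⟨⟨fun x => ℓ (c x) x, ?_, fun σ hσ => ⟨ℓ ⟨σ, hσ⟩, key ⟨σ, hσ⟩⟩⟩,
    fun v => hℓ _ v v.2 (hc v)⟩
  refine (locallyFinite_of_finite fun σ : F.cones => (σ.1 : Set E)).continuous ?_
    (fun σ => F.isClosed_of_mem σ.2) fun σ =>
      (LinearMap.continuous_of_finiteDimensional (ℓ σ)).continuousOn.congr (key σ)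
  exact Set.eq_univ_of_forall fun x => Set.mem_iUnion.2 ⟨c x, hc x⟩

theorem map_weight {V : Type*} [NormedAddCommGroup V] [NormedSpace ℝ V] (φ : F.PL V)
    {a : F.Gen →₀ ℕ} (ha : F.Spans a.support) :
    (φ : E → V) (Finsupp.weight (fun v : F.Gen => (v : E)) a) =
      Finsupp.weight (fun v : F.Gen => (φ : E → V) v) a := by
  obtain ⟨σ, hσ, h⟩ := (F.spans_iff _).1 ha
  obtain ⟨ℓ, hℓ⟩ := φ.2.2 σ hσ
  rw [Finsupp.weight_apply, Finsupp.weight_apply, Finsupp.sum, Finsupp.sum, hℓ, map_sum]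
  · refine Finset.sum_congr rfl fun v hv => ?_
    rw [map_nsmul, hℓ (h v hv)]
  · exact Submodule.sum_mem _ fun v hv => nsmul_mem (h v hv) _

/-- The piecewise linear function that is `1` at `v` and `0` at the other generators reads off the
exponent of `v` from the degree. -/
theorem eq_of_weight_eq {a b : F.Gen →₀ ℕ} (ha : F.Spans a.support) (hb : F.Spans b.support)
    (h : Finsupp.weight (fun v : F.Gen => (v : E)) a =
      Finsupp.weight (fun v : F.Gen => (v : E)) b) : a = b := by
  classical
  ext v
  obtain ⟨χ, hχ⟩ := F.exists_PL_eq fun w => if w = v then 1 else 0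
  have key : ∀ c : F.Gen →₀ ℕ, Finsupp.weight (fun w : F.Gen => (χ : E → ℝ) w) c = c v := by
    intro c
    rw [Finsupp.weight_apply, Finsupp.sum_eq_single v]
    · simp [hχ]
    · intro w _ hw
      rw [hχ, if_neg (fun h => hw (Subtype.ext h)), smul_zero]
    · simp
  have h1 := F.map_weight χ ha
  rw [h, F.map_weight χ hb, key, key] at h1
  exact_mod_cast h1.symm

end Lattice

end CompleteRegularFan

/-! ### Convexity of piecewise linear functions and strictly convex support functions. -/

theorem exists_pos_add_smul_mem {E : Type*} [NormedAddCommGroup E] [NormedSpace ℝ E] {U : Set E}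
    {x : E} (hU : U ∈ 𝓝 x) (y : E) : ∃ ε : ℝ, 0 < ε ∧ x + ε • y ∈ U := by
  have hc : Continuous fun ε : ℝ => x + ε • y := by fun_prop
  have h : ∀ᶠ ε in 𝓝 (0 : ℝ), x + ε • y ∈ U := hc.continuousAt (by simpa using hU)
  obtain ⟨ε, hε, hε0⟩ := ((h.filter_mono nhdsWithin_le_nhds).and
    (self_mem_nhdsWithin (s := Set.Ioi (0 : ℝ)))).exists
  exact ⟨ε, hε0, hε⟩

theorem linearMap_eq_of_eqOn_nhds {E V : Type*} [NormedAddCommGroup E] [NormedSpace ℝ E]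
    [AddCommGroup V] [Module ℝ V] {ℓ ℓ' : E →ₗ[ℝ] V} {U : Set E} {x : E} (hU : U ∈ 𝓝 x)
    (h : Set.EqOn ℓ ℓ' U) : ℓ = ℓ' := by
  ext y
  obtain ⟨ε, hε, hy⟩ := exists_pos_add_smul_mem hU y
  have h1 := h hy
  rw [map_add, map_add, h (mem_of_mem_nhds hU), add_right_inj, map_smul, map_smul] at h1
  exact smul_right_injective V hε.ne' h1

namespace CompleteRegularFan

variable {E : Type*} [NormedAddCommGroup E] [NormedSpace ℝ E] {L : Submodule ℤ E}
  (F : CompleteRegularFan L)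

theorem PL_map_smul {V : Type*} [NormedAddCommGroup V] [NormedSpace ℝ V] (φ : F.PL V) {c : ℝ}
    (hc : 0 ≤ c) (x : E) : (φ : E → V) (c • x) = c • (φ : E → V) x := by
  obtain ⟨σ, hσ, hx⟩ := F.complete x
  obtain ⟨ℓ, hℓ⟩ := φ.2.2 σ hσ
  rw [hℓ hx, hℓ (PointedCone.smul_mem _ hc hx), map_smul]

/-- For `z` interior to `σ`, a short step `ε • y` stays in `σ`; subadditivity at `z` and `ε • y`
then compares `ε * ℓ y` with `ε * ψ y`. -/
theorem IsUpperConvex.le_of_eqOn {F : CompleteRegularFan L} {ψ : F.PL ℝ} (hψ : F.IsUpperConvex ψ)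
    {σ : PointedCone ℝ E} (hσ : (interior (σ : Set E)).Nonempty) {ℓ : E →ₗ[ℝ] ℝ}
    (hℓ : Set.EqOn (ψ : E → ℝ) ℓ (σ : Set E)) (y : E) : ℓ y ≤ (ψ : E → ℝ) y := by
  obtain ⟨z, hz⟩ := hσ
  obtain ⟨ε, hε, hy⟩ := exists_pos_add_smul_mem (mem_interior_iff_mem_nhds.1 hz) y
  have h := hψ z (ε • y)
  rw [hℓ hy, hℓ (interior_subset hz), map_add, F.PL_map_smul ψ hε.le, map_smul, smul_eq_mul,
    smul_eq_mul] at h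
  exact le_of_mul_le_mul_left (by linarith) hε

/-- Where an upper convex function agrees with the linear function of one of the cones, it is
additive. -/
theorem IsUpperConvex.eq_add {F : CompleteRegularFan L} {ψ : F.PL ℝ} (hψ : F.IsUpperConvex ψ)
    {σ : PointedCone ℝ E} (hσ : (interior (σ : Set E)).Nonempty) {ℓ : E →ₗ[ℝ] ℝ}
    (hℓ : Set.EqOn (ψ : E → ℝ) ℓ (σ : Set E)) {x y : E} (hx : (ψ : E → ℝ) x = ℓ x)
    (hy : (ψ : E → ℝ) y = ℓ y) : (ψ : E → ℝ) (x + y) = ℓ (x + y) := by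
  refine le_antisymm ?_ (hψ.le_of_eqOn hσ hℓ _)
  rw [map_add, ← hx, ← hy]
  exact hψ x y

/-- Adding a linear function does not affect convexity, so any representative of the class may be
used. -/
theorem isUpperConvex_of_mkQ_mem {χ : F.PL ℝ} (h : F.globallyLinear.mkQ χ ∈ F.kahlerCone) :
    F.IsUpperConvex χ := by
  obtain ⟨ψ, hψ, heq⟩ := h
  rw [Submodule.mkQ_apply, Submodule.mkQ_apply, Submodule.Quotient.eq] at heq
  obtain ⟨ℓ, hℓ⟩ := heq
  have h1 : ∀ x, (ψ : E → ℝ) x = (χ : E → ℝ) x + ℓ x := fun x => by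
    have := congrFun hℓ x
    simp only [LinearMap.ltoFun_apply, Submodule.subtype_apply, Submodule.coe_sub,
      Pi.sub_apply] at this
    linarith
  intro x y
  have h2 := hψ x y
  rw [h1, h1, h1, map_add] at h2
  linarith

variable [FiniteDimensional ℝ E] [DiscreteTopology L] [IsZLattice ℝ L]

/-- If the generators form a full basis, their sum is interior. If a basis vector is missing, moving
in its direction leaves the cone at once. -/
theorem isMaximalCone_iff {σ : PointedCone ℝ E} :
    F.IsMaximalCone σ ↔ σ ∈ F.cones ∧ (interior (σ : Set E)).Nonempty := by
  refine and_congr_right fun hσ => ?_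
  have hcard : ∀ T : Set (Fin (Module.finrank ℤ L)),
      T.ncard = Module.finrank ℝ E ↔ T = Set.univ := by
    intro T
    rw [← ZLattice.rank ℝ L]
    refine ⟨fun h => Set.eq_univ_of_univ_subset (Set.eq_of_subset_of_ncard_le (Set.subset_univ T)
      (by simp [h])).ge, fun h => by simp [h]⟩
  constructor
  · rintro ⟨s, hs, hn⟩
    obtain ⟨B, T, rfl, -, -⟩ := hs.1.exists_basis
    rw [Set.ncard_image_of_injective _ B.injective, hcard] at hn
    refine ⟨∑ i, B i, mem_interior.2 ⟨⋂ i, {x | 0 < B.coord i x}, fun x hx => ?_,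
      isOpen_iInter_of_finite fun i => isOpen_lt continuous_const
        (LinearMap.continuous_of_finiteDimensional _), ?_⟩⟩
    · rw [hs.2]
      exact (mem_hull_image_iff B T x).2
        ⟨fun i => (Set.mem_iInter.1 hx i).le, fun i hi => absurd (hn ▸ Set.mem_univ i) hi⟩
    · simp [Finsupp.single_apply]
  · rintro ⟨x, hx⟩
    obtain ⟨s, hs⟩ := F.regular σ hσ
    obtain ⟨B, T, rfl, -, -⟩ := hs.1.exists_basis
    refine ⟨_, hs, ?_⟩
    rw [Set.ncard_image_of_injective _ B.injective, hcard]
    refine Set.eq_univ_of_forall fun i => ?_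
    by_contra hi
    obtain ⟨ε, hε, hy⟩ := exists_pos_add_smul_mem (mem_interior_iff_mem_nhds.1 hx) (B i)
    have hx' := interior_subset hx
    rw [hs.2, SetLike.mem_coe, mem_hull_image_iff] at hx' hy
    have h := hy.2 i hi
    rw [map_add, Finsupp.add_apply, hx'.2 i hi] at h
    simp [hε.ne'] at h

/-- Every nonempty open set meets the interior of a maximal cone. -/
theorem exists_isMaximalCone_interior {U : Set E} (hU : IsOpen U) (hne : U.Nonempty) :
    ∃ σ, F.IsMaximalCone σ ∧ (U ∩ interior (σ : Set E)).Nonempty := by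
  have : CompleteSpace E := FiniteDimensional.complete ℝ E
  -- Frontiers of closed sets are nowhere dense; a point avoiding all of them is interior to any
  -- cone that contains it.
  have hd : Dense (⋂ σ ∈ F.cones, (frontier (σ : Set E))ᶜ) :=
    dense_biInter_of_isOpen (fun σ _ => isClosed_frontier.isOpen_compl) F.finite_cones.countable
      fun σ hσ => interior_eq_empty_iff_dense_compl.1 (interior_frontier (F.isClosed_of_mem hσ))
  obtain ⟨x, hxU, hx⟩ := hd.inter_open_nonempty U hU hne
  obtain ⟨σ, hσ, hxσ⟩ := F.complete x
  have hxi : x ∈ interior (σ : Set E) := by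
    by_contra h
    exact Set.mem_iInter₂.1 hx σ hσ ⟨subset_closure hxσ, h⟩
  exact ⟨σ, F.isMaximalCone_iff.2 ⟨hσ, x, hxi⟩, x, hxU, hxi⟩

theorem exists_isMaximalCone_mem (x : E) : ∃ σ, F.IsMaximalCone σ ∧ x ∈ σ := by
  have hfin : {σ | F.IsMaximalCone σ}.Finite := F.finite_cones.subset fun _ h => h.1
  have hcl : IsClosed (⋃ σ ∈ {σ | F.IsMaximalCone σ}, (σ : Set E)) :=
    hfin.isClosed_biUnion fun σ hσ => F.isClosed_of_mem hσ.1
  by_contra! h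
  obtain ⟨σ, hσ, y, hy, hyσ⟩ := F.exists_isMaximalCone_interior hcl.isOpen_compl
    ⟨x, by simpa using h⟩
  exact hy (Set.mem_biUnion hσ (interior_subset hyσ))

theorem exists_generator_notMem {σ τ : PointedCone ℝ E} (hσ : F.IsMaximalCone σ)
    (hτ : F.IsMaximalCone τ) (hne : σ ≠ τ) : ∃ v : F.Gen, (v : E) ∈ σ ∧ (v : E) ∉ τ := by
  obtain ⟨hσ, s, hs, hsn⟩ := hσ
  obtain ⟨hτ, t, ht, htn⟩ := hτ
  by_contra! h
  refine hne ?_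
  have hst : s ⊆ t := by
    rw [F.generators_eq hσ hs, F.generators_eq hτ ht]
    exact fun v hv => ⟨hv.1, h ⟨v, hv.1⟩ hv.2⟩
  rw [hs.2, ht.2, Set.eq_of_subset_of_ncard_le hst (by rw [hsn, htn]) ht.1.finite]

/-- A strictly convex support function agrees with the linear function of a maximal cone only on
that cone. -/
theorem IsStrictlyConvexSupport.mem_of_eq {F : CompleteRegularFan L} {ψ : F.PL ℝ}
    (hψ : F.IsStrictlyConvexSupport ψ) {σ : PointedCone ℝ E} (hσ : F.IsMaximalCone σ)
    {ℓ : E →ₗ[ℝ] ℝ} (hℓ : Set.EqOn (ψ : E → ℝ) ℓ (σ : Set E)) {y : E}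
    (hy : (ψ : E → ℝ) y = ℓ y) : y ∈ σ := by
  by_contra hyσ
  have hne := (F.isMaximalCone_iff.1 hσ).2
  obtain ⟨z, hz⟩ := hne
  obtain ⟨ε, hε, hεy⟩ := exists_pos_add_smul_mem
    ((F.isClosed_of_mem hσ.1).isOpen_compl.mem_nhds hyσ) z
  -- On `y + ε • interior σ` additivity gives `ψ = ℓ`. Outside `σ` this set still contains `y + ε •
  -- z`, so its open part there meets another maximal cone, whose linear function must then be `ℓ`
  -- too.
  have hopen : IsOpen {x : E | x ∉ (σ : Set E) ∧ ε⁻¹ • (x - y) ∈ interior (σ : Set E)} :=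
    (F.isClosed_of_mem hσ.1).isOpen_compl.inter (isOpen_interior.preimage (by fun_prop))
  obtain ⟨τ, hτ, x, ⟨hxU, hxτ⟩⟩ := F.exists_isMaximalCone_interior hopen
    ⟨y + ε • z, hεy, by simpa [smul_smul, hε.ne'] using hz⟩
  obtain ⟨ℓ', hℓ'⟩ := ψ.2.2 τ hτ.1
  refine hψ.2 σ τ hσ hτ ?_ ℓ ℓ' hℓ hℓ' (linearMap_eq_of_eqOn_nhds
    ((hopen.inter isOpen_interior).mem_nhds ⟨hxU, hxτ⟩) ?_)
  · rintro rfl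
    exact hxU.1 (interior_subset hxτ)
  · rintro w ⟨hwU, hwτ⟩
    rw [← hℓ' (interior_subset hwτ)]
    have hw : w = y + ε • (ε⁻¹ • (w - y)) := by simp [smul_smul, hε.ne']
    rw [hw]
    exact (hψ.1.eq_add ⟨z, hz⟩ hℓ hy
      (hℓ (PointedCone.smul_mem _ hε.le (interior_subset hwU.2)))).symm

/-- Let `ℓ` be the linear function of a maximal cone containing the degree. Then `ℓ ≤ ψ` termwise,
strictly at a generator of the support outside that cone. -/
theorem IsStrictlyConvexSupport.map_weight_lt {F : CompleteRegularFan L} {ψ : F.PL ℝ}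
    (hψ : F.IsStrictlyConvexSupport ψ) {a : F.Gen →₀ ℕ} (ha : ¬ F.Spans a.support) :
    (ψ : E → ℝ) (Finsupp.weight (fun v : F.Gen => (v : E)) a) <
      Finsupp.weight (fun v : F.Gen => (ψ : E → ℝ) v) a := by
  obtain ⟨σ, hσ, hx⟩ := F.exists_isMaximalCone_mem (Finsupp.weight (fun v : F.Gen => (v : E)) a)
  obtain ⟨ℓ, hℓ⟩ := ψ.2.2 σ hσ.1
  have hle := hψ.1.le_of_eqOn (F.isMaximalCone_iff.1 hσ).2 hℓ
  have hv : ∃ v ∈ a.support, (v : E) ∉ σ := by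
    by_contra! h
    exact ha ((F.spans_iff _).2 ⟨σ, hσ.1, h⟩)
  obtain ⟨v, hva, hvσ⟩ := hv
  rw [hℓ hx, Finsupp.weight_apply, Finsupp.weight_apply, Finsupp.sum, Finsupp.sum, map_sum]
  refine Finset.sum_lt_sum (fun w _ => ?_) ⟨v, hva, ?_⟩
  · rw [map_nsmul]
    exact nsmul_le_nsmul_right (hle w) _
  · rw [map_nsmul]
    refine nsmul_lt_nsmul_right (Finsupp.mem_support_iff.1 hva) ?_
    exact lt_of_le_of_ne (hle v) fun h => hvσ (hψ.mem_of_eq hσ hℓ h.symm)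

theorem exists_isStrictlyConvexSupport (hK : (interior F.kahlerCone).Nonempty) :
    ∃ ψ : F.PL ℝ, F.IsStrictlyConvexSupport ψ := by
  obtain ⟨c, hc⟩ := hK
  obtain ⟨ψ, rfl⟩ := F.globallyLinear.mkQ_surjective c
  have hψ := F.isUpperConvex_of_mkQ_mem (interior_subset hc)
  refine ⟨ψ, hψ, fun σ τ hσ hτ hne ℓ ℓ' hℓ hℓ' heq => ?_⟩
  subst heq
  obtain ⟨v, hvσ, hvτ⟩ := F.exists_generator_notMem hσ hτ hne
  -- Lowering `ψ` at `v` alone changes nothing on `τ`, but breaks the inequality `ℓ ≤ ψ` at `v`,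
  -- which is an equality when `σ` and `τ` share `ℓ`.
  obtain ⟨χ, hχ⟩ := F.exists_PL_eq fun w => open scoped Classical in if w = v then -1 else 0
  have hcont : Continuous fun ε : ℝ => F.globallyLinear.mkQ (ψ + ε • χ) :=
    F.globallyLinear.continuous_mkQ.comp (by fun_prop)
  have hev : ∀ᶠ ε in 𝓝 (0 : ℝ), F.globallyLinear.mkQ (ψ + ε • χ) ∈ F.kahlerCone :=
    hcont.continuousAt (by simpa using mem_interior_iff_mem_nhds.1 hc)
  obtain ⟨ε, hε, hε0⟩ := ((hev.filter_mono nhdsWithin_le_nhds).and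
    (self_mem_nhdsWithin (s := Set.Ioi (0 : ℝ)))).exists
  have hconv := F.isUpperConvex_of_mkQ_mem hε
  have hτi := (F.isMaximalCone_iff.1 hτ).2
  obtain ⟨z, hz⟩ := hτi
  obtain ⟨δ, hδ, hzv⟩ := exists_pos_add_smul_mem (mem_interior_iff_mem_nhds.1 hz) (v : E)
  have hzτ := interior_subset hz
  have hχτ : ∀ x ∈ τ, (χ : E → ℝ) x = 0 := by
    intro x hx
    obtain ⟨m, hm⟩ := χ.2.2 τ hτ.1
    have hg := F.isGenerators_of_mem hτ.1
    rw [hm hx]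
    rw [hg.2] at hx
    refine eqOn_hull (ℓ' := 0) ?_ hx
    rintro w ⟨hw, hwτ⟩
    rw [← hm hwτ, hχ ⟨w, hw⟩, if_neg, LinearMap.zero_apply]
    rintro rfl
    exact hvτ hwτ
  -- Both `z` and `z + δ • v` lie in `τ`, where `χ` vanishes, so this inequality reduces to `0 ≤ -ε
  -- * δ`.
  have h := hconv z (δ • (v : E))
  simp only [Submodule.coe_add, Submodule.coe_smul, Pi.add_apply, Pi.smul_apply, smul_eq_mul] at h
  rw [hχτ _ hzv, hχτ _ hzτ, hℓ' hzv, hℓ' hzτ, F.PL_map_smul ψ hδ.le, F.PL_map_smul χ hδ.le,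
    hℓ hvσ, hχ v, if_pos rfl, map_add, map_smul, smul_eq_mul, smul_eq_mul] at h
  have : 0 < ε * δ := mul_pos hε0 hδ
  linarith

end CompleteRegularFan

open MvPolynomial

/-! ### Initial forms of binomials. -/

section Groebner

variable {κ : Type*}

theorem coeff_initialForm (ω : κ → ℝ) (p : MvPolynomial κ ℂ) (a : κ →₀ ℕ) :
    coeff a (initialForm ω p) = open scoped Classical in
      if ∀ b ∈ p.support, Finsupp.weight ω b ≤ Finsupp.weight ω a then coeff a p else 0 := by
  classical
  rw [initialForm, coeff_sum]
  simp only [coeff_monomial]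
  rw [Finset.sum_ite_eq']
  by_cases ha : a ∈ p.support
  · simp [ha]
  · simp [notMem_support_iff.1 ha]

theorem initialForm_binomial {ω : κ → ℝ} {a b : κ →₀ ℕ}
    (h : Finsupp.weight ω b < Finsupp.weight ω a) (e : ℂ) :
    initialForm ω (monomial a 1 - monomial b e) = monomial a 1 := by
  classical
  have hab : b ≠ a := by
    rintro rfl
    exact lt_irrefl _ h
  have ha : a ∈ (monomial a 1 - monomial b e : MvPolynomial κ ℂ).support := by
    simp [hab]
  have hsupp : ∀ m ∈ (monomial a 1 - monomial b e : MvPolynomial κ ℂ).support, m = a ∨ m = b := by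
    intro m hm
    by_contra! hne
    simp [coeff_monomial, hne.1.symm, hne.2.symm] at hm
  ext m
  rw [coeff_initialForm]
  by_cases hm : m = a
  · subst hm
    rw [if_pos]
    · simp [coeff_monomial, hab]
    · intro n hn
      rcases hsupp n hn with rfl | rfl
      exacts [le_rfl, h.le]
  · rw [coeff_monomial, if_neg (Ne.symm hm)]
    split_ifs with hmax
    · by_contra hc
      rcases hsupp m (mem_support_iff.2 hc) with rfl | rfl
      · exact hm rfl
      · exact (hmax a ha).not_gt h
    · rfl

end Groebner

namespace CompleteRegularFan

/-! ### Squarefree exponents and normalised monomials. -/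

section Monomials

variable {κ : Type*}

/-- The exponent vector of the squarefree monomial with the variables in `P`. -/
noncomputable def squarefreeExponent (P : Finset κ) : κ →₀ ℕ := ∑ v ∈ P, Finsupp.single v 1

theorem squarefreeExponent_apply [DecidableEq κ] (P : Finset κ) (v : κ) :
    squarefreeExponent P v = if v ∈ P then 1 else 0 := by
  simp [squarefreeExponent, Finsupp.single_apply]

theorem support_squarefreeExponent (P : Finset κ) : (squarefreeExponent P).support = P := by
  classical
  ext v
  simp [squarefreeExponent_apply]

theorem squarefreeExponent_le_iff {P : Finset κ} {a : κ →₀ ℕ} :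
    squarefreeExponent P ≤ a ↔ P ⊆ a.support := by
  classical
  constructor
  · intro h
    rw [← support_squarefreeExponent P]
    exact Finsupp.support_mono h
  · intro h v
    rw [squarefreeExponent_apply]
    split_ifs with hv
    · exact Nat.one_le_iff_ne_zero.2 (Finsupp.mem_support_iff.1 (h hv))
    · exact Nat.zero_le _

theorem weight_squarefreeExponent {V : Type*} [AddCommGroup V] (w : κ → V) (P : Finset κ) :
    Finsupp.weight w (squarefreeExponent P) = ∑ v ∈ P, w v := by
  simp [squarefreeExponent, map_sum, Finsupp.weight_single]

theorem prod_X_eq_monomial (P : Finset κ) :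
    ∏ v ∈ P, (X v : MvPolynomial κ ℂ) = monomial (squarefreeExponent P) 1 :=
  (monomial_sum_one P fun v => Finsupp.single v 1).symm

/-- The monomial `exp(∑ a_i w_i) z^a`. -/
noncomputable def expMonomial (w : κ → ℂ) (a : κ →₀ ℕ) : MvPolynomial κ ℂ :=
  monomial a (Complex.exp (Finsupp.weight w a))

theorem expMonomial_add (w : κ → ℂ) (a b : κ →₀ ℕ) :
    expMonomial w (a + b) = expMonomial w a * expMonomial w b := by
  rw [expMonomial, expMonomial, expMonomial, monomial_mul, map_add, Complex.exp_add]

end Monomials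

/-! ### The Stanley–Reisner ideal and the degree functionals. -/

variable {E : Type*} [NormedAddCommGroup E] [NormedSpace ℝ E] {L : Submodule ℤ E}
  (F : CompleteRegularFan L)

theorem mem_stanleyReisner_iff {p : MvPolynomial F.Gen ℂ} :
    p ∈ F.stanleyReisner ↔
      ∀ a ∈ p.support, ∃ P, F.IsPrimitiveCollection P ∧ squarefreeExponent P ≤ a := by
  have h : F.stanleyReisner = Ideal.span ((fun a => monomial a 1) ''
      (squarefreeExponent '' {P | F.IsPrimitiveCollection P})) := by
    rw [stanleyReisner, Set.image_image]
    simp only [prod_X_eq_monomial]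
  rw [h, mem_ideal_span_monomial_image]
  simp

/-- The functional that takes the coefficients, normalised by `φ`, of the monomials of degree `x`
and adds them up. -/
noncomputable def degreeSum (φ : F.PL ℂ) (x : E) : MvPolynomial F.Gen ℂ →ₗ[ℂ] ℂ :=
  (basisMonomials F.Gen ℂ).constr ℂ fun a => open scoped Classical in
    if Finsupp.weight (fun v : F.Gen => (v : E)) a = x then
      Complex.exp (-Finsupp.weight (fun v : F.Gen => (φ : E → ℂ) v) a) else 0

theorem degreeSum_monomial (φ : F.PL ℂ) (x : E) (a : F.Gen →₀ ℕ) (c : ℂ) :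
    F.degreeSum φ x (monomial a c) = open scoped Classical in
      if Finsupp.weight (fun v : F.Gen => (v : E)) a = x then
        c * Complex.exp (-Finsupp.weight (fun v : F.Gen => (φ : E → ℂ) v) a) else 0 := by
  have h : monomial a c = c • basisMonomials F.Gen ℂ a := by
    rw [coe_basisMonomials, smul_monomial, smul_eq_mul, mul_one]
  rw [h, map_smul, degreeSum, Module.Basis.constr_basis]
  split_ifs <;> simp

theorem degreeSum_expMonomial (φ : F.PL ℂ) (x : E) (a : F.Gen →₀ ℕ) :
    F.degreeSum φ x (expMonomial (fun v : F.Gen => (φ : E → ℂ) v) a) = open scoped Classical in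
      if Finsupp.weight (fun v : F.Gen => (v : E)) a = x then 1 else 0 := by
  rw [expMonomial, degreeSum_monomial, ← Complex.exp_add, add_neg_cancel, Complex.exp_zero]

theorem degreeSum_eq_zero {φ : F.PL ℂ} {f : MvPolynomial F.Gen ℂ} (hf : f ∈ F.quantumIdeal φ)
    (x : E) : F.degreeSum φ x f = 0 := by
  -- Quantifying over multiples lets the induction pass through ideal operations. A normalised
  -- monomial times a generator is a difference of two normalised monomials of one degree, which
  -- count equally.
  suffices h : ∀ g, F.degreeSum φ x (g * f) = 0 by simpa using h 1
  induction hf using Submodule.span_induction with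
  | mem f hf =>
    obtain ⟨a, b, hab, rfl⟩ := hf
    intro g
    induction g using MvPolynomial.induction_on' with
    | monomial m c =>
      have h : monomial m c = C (c * (Complex.exp (Finsupp.weight
          (fun v : F.Gen => (φ : E → ℂ) v) m))⁻¹) *
            expMonomial (fun v : F.Gen => (φ : E → ℂ) v) m := by
        rw [expMonomial, C_mul_monomial, mul_assoc, inv_mul_cancel₀ (Complex.exp_ne_zero _),
          mul_one]
      change F.degreeSum φ x (monomial m c * (expMonomial _ a - expMonomial _ b)) = 0
      rw [h, mul_assoc, mul_sub, ← expMonomial_add, ← expMonomial_add, ← smul_eq_C_mul, map_smul,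
        map_sub, degreeSum_expMonomial, degreeSum_expMonomial, map_add, map_add, hab, sub_self,
        smul_zero]
    | add p q hp hq => rw [add_mul, map_add, hp, hq, add_zero]
  | zero => simp
  | add p q _ _ hp hq => intro g; rw [mul_add, map_add, hp, hq, add_zero]
  | smul r p _ hp => intro g; rw [smul_eq_mul, ← mul_assoc]; exact hp _

/-! ### Rewriting with primitive binomials, normal forms and the Gröbner basis. -/

variable [FiniteDimensional ℝ E] [DiscreteTopology L] [IsZLattice ℝ L]

theorem primitiveExponent_spans (P : Finset F.Gen) : F.Spans (F.primitiveExponent P).support :=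
  (F.primitiveExponent_spec P).spans

theorem weight_primitiveExponent (P : Finset F.Gen) :
    Finsupp.weight (fun v : F.Gen => (v : E)) (F.primitiveExponent P) =
      Finsupp.weight (fun v : F.Gen => (v : E)) (squarefreeExponent P) := by
  rw [weight_squarefreeExponent]
  exact (F.primitiveExponent_spec P).2

/-- Since `φ` is linear on the minimal cone, `φ(v_P) = ∑ c_j φ(v_j)`; up to a unit, the binomial is
therefore one of the defining generators of the quantum ideal. -/
theorem C_mul_binomial (φ : F.PL ℂ) (P : Finset F.Gen) :
    C (Complex.exp (∑ v ∈ P, (φ : E → ℂ) v)) * F.binomial φ P =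
      expMonomial (fun v : F.Gen => (φ : E → ℂ) v) (squarefreeExponent P) -
        expMonomial (fun v : F.Gen => (φ : E → ℂ) v) (F.primitiveExponent P) := by
  rw [binomial, prod_X_eq_monomial, mul_sub, C_mul_monomial, C_mul_monomial, quantumFactor,
    ← Complex.exp_add, add_sub_cancel, mul_one, expMonomial, expMonomial,
    weight_squarefreeExponent, ← F.map_weight φ (F.primitiveExponent_spans P),
    weight_primitiveExponent, weight_squarefreeExponent]

theorem binomial_mem_quantumIdeal (φ : F.PL ℂ) (P : Finset F.Gen) :
    F.binomial φ P ∈ F.quantumIdeal φ := by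
  have h : C (Complex.exp (∑ v ∈ P, (φ : E → ℂ) v)) * F.binomial φ P ∈ F.quantumIdeal φ := by
    rw [C_mul_binomial]
    exact Ideal.subset_span ⟨_, _, (F.weight_primitiveExponent P).symm, rfl⟩
  have hu : IsUnit (C (Complex.exp (∑ v ∈ P, (φ : E → ℂ) v)) : MvPolynomial F.Gen ℂ) :=
    (Complex.exp_ne_zero _).isUnit.map C
  exact (Ideal.unit_mul_mem_iff_mem _ hu).1 h

/-- Rewriting with the binomial of a primitive collection contained in the support of `a`. -/
theorem exists_rewrite (φ : F.PL ℂ) {a : F.Gen →₀ ℕ} (ha : ¬ F.Spans a.support) :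
    ∃ (P : Finset F.Gen) (b : F.Gen →₀ ℕ), F.IsPrimitiveCollection P ∧
      a = b + squarefreeExponent P ∧
      expMonomial (fun v : F.Gen => (φ : E → ℂ) v) a -
        expMonomial (fun v : F.Gen => (φ : E → ℂ) v) (b + F.primitiveExponent P) ∈
          Ideal.span (F.primitiveBinomials φ) := by
  obtain ⟨P, hPa, hP⟩ := F.exists_isPrimitiveCollection_subset ha
  obtain ⟨b, rfl⟩ := exists_add_of_le (squarefreeExponent_le_iff.2 hPa)
  refine ⟨P, b, hP, add_comm _ _, ?_⟩
  rw [add_comm _ b, expMonomial_add, expMonomial_add, ← mul_sub, ← C_mul_binomial]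
  exact Ideal.mul_mem_left _ _ (Ideal.mul_mem_left _ _ (Ideal.subset_span ⟨P, hP, rfl⟩))

variable {F} in
-- Weights are real, so a strict drop alone would not ensure termination; finiteness of the set of
-- primitive collections makes the drop uniform.
theorem IsStrictlyConvexSupport.exists_gap {ψ : F.PL ℝ} (hψ : F.IsStrictlyConvexSupport ψ) :
    ∃ ε : ℝ, 0 < ε ∧ ∀ P, F.IsPrimitiveCollection P →
      Finsupp.weight (fun v : F.Gen => (ψ : E → ℝ) v) (F.primitiveExponent P) + ε ≤
        Finsupp.weight (fun v : F.Gen => (ψ : E → ℝ) v) (squarefreeExponent P) := by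
  have h : ∀ᶠ ε in 𝓝 (0 : ℝ), ∀ P ∈ {P | F.IsPrimitiveCollection P},
      Finsupp.weight (fun v : F.Gen => (ψ : E → ℝ) v) (F.primitiveExponent P) + ε ≤
        Finsupp.weight (fun v : F.Gen => (ψ : E → ℝ) v) (squarefreeExponent P) := by
    refine (Filter.eventually_all_finite F.finite_primitiveCollections).2 fun P hP => ?_
    have hlt := hψ.map_weight_lt (a := squarefreeExponent P)
      (by rw [support_squarefreeExponent]; exact hP.1)
    rw [← weight_primitiveExponent, F.map_weight ψ (F.primitiveExponent_spans P)] at hlt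
    filter_upwards [eventually_le_nhds (sub_pos.2 hlt)] with ε hε
    linarith
  obtain ⟨ε, hε, hε0⟩ := ((h.filter_mono nhdsWithin_le_nhds).and
    (self_mem_nhdsWithin (s := Set.Ioi (0 : ℝ)))).exists
  exact ⟨ε, hε0, hε⟩

variable {F} in
/-- Modulo the binomials of the primitive collections, every monomial is equivalent to one whose
variables belong to a common cone. -/
theorem IsStrictlyConvexSupport.exists_normalForm {ψ : F.PL ℝ} (hψ : F.IsStrictlyConvexSupport ψ)
    (φ : F.PL ℂ) (a : F.Gen →₀ ℕ) :
    ∃ c : F.Gen →₀ ℕ, F.Spans c.support ∧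
      Finsupp.weight (fun v : F.Gen => (v : E)) c = Finsupp.weight (fun v : F.Gen => (v : E)) a ∧
      expMonomial (fun v : F.Gen => (φ : E → ℂ) v) a -
        expMonomial (fun v : F.Gen => (φ : E → ℂ) v) c ∈ Ideal.span (F.primitiveBinomials φ) := by
  obtain ⟨ε, hε, hgap⟩ := hψ.exists_gap
  -- Induction on a bound `n * ε` for the excess of the weight over `ψ(degree)`: rewriting preserves
  -- the degree and lowers the excess by at least `ε`. For `n = 0` the monomial must already be
  -- standard.
  have key : ∀ (n : ℕ) (a : F.Gen →₀ ℕ),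
      Finsupp.weight (fun v : F.Gen => (ψ : E → ℝ) v) a ≤
        (ψ : E → ℝ) (Finsupp.weight (fun v : F.Gen => (v : E)) a) + n * ε →
      ∃ c : F.Gen →₀ ℕ, F.Spans c.support ∧
        Finsupp.weight (fun v : F.Gen => (v : E)) c =
          Finsupp.weight (fun v : F.Gen => (v : E)) a ∧
        expMonomial (fun v : F.Gen => (φ : E → ℂ) v) a -
          expMonomial (fun v : F.Gen => (φ : E → ℂ) v) c ∈
            Ideal.span (F.primitiveBinomials φ) := by
    intro n
    induction n with
    | zero =>
      intro a ha
      refine ⟨a, ?_, rfl, by simp⟩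
      by_contra hs
      have := hψ.map_weight_lt hs
      simp only [Nat.cast_zero, zero_mul, add_zero] at ha
      linarith
    | succ n ih =>
      intro a ha
      by_cases hs : F.Spans a.support
      · exact ⟨a, hs, rfl, by simp⟩
      obtain ⟨P, b, hP, rfl, hmem⟩ := F.exists_rewrite φ hs
      have hw : Finsupp.weight (fun v : F.Gen => (v : E)) (b + F.primitiveExponent P) =
          Finsupp.weight (fun v : F.Gen => (v : E)) (b + squarefreeExponent P) := by
        rw [map_add, map_add, weight_primitiveExponent]
      obtain ⟨c, hc, hcw, hcm⟩ := ih (b + F.primitiveExponent P) (by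
        rw [hw]
        have := hgap P hP
        push_cast at ha
        rw [map_add (Finsupp.weight fun v : F.Gen => (ψ : E → ℝ) v)] at ha ⊢
        linarith)
      refine ⟨c, hc, hcw.trans hw, ?_⟩
      rw [← sub_add_sub_cancel]
      exact Ideal.add_mem _ hmem hcm
  obtain ⟨n, hn⟩ := exists_nat_ge ((Finsupp.weight (fun v : F.Gen => (ψ : E → ℝ) v) a -
    (ψ : E → ℝ) (Finsupp.weight (fun v : F.Gen => (v : E)) a)) / ε)
  refine key n a ?_
  rw [div_le_iff₀ hε] at hn
  linarith

variable {F} in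
theorem IsStrictlyConvexSupport.quantumIdeal_eq_span {ψ : F.PL ℝ}
    (hψ : F.IsStrictlyConvexSupport ψ) (φ : F.PL ℂ) :
    F.quantumIdeal φ = Ideal.span (F.primitiveBinomials φ) := by
  refine le_antisymm (Ideal.span_le.2 ?_) (Ideal.span_le.2 ?_)
  · rintro _ ⟨a, b, hab, rfl⟩
    obtain ⟨c, hc, hca, hac⟩ := hψ.exists_normalForm φ a
    obtain ⟨d, hd, hdb, hbd⟩ := hψ.exists_normalForm φ b
    obtain rfl := F.eq_of_weight_eq hc hd (by rw [hca, hdb, hab])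
    simpa [expMonomial] using Ideal.sub_mem _ hac hbd
  · rintro _ ⟨P, _, rfl⟩
    exact F.binomial_mem_quantumIdeal φ P

variable {F} in
theorem IsStrictlyConvexSupport.initialForm_binomial {ψ : F.PL ℝ}
    (hψ : F.IsStrictlyConvexSupport ψ) (φ : F.PL ℂ) {P : Finset F.Gen}
    (hP : F.IsPrimitiveCollection P) :
    initialForm (fun v : F.Gen => (ψ : E → ℝ) v) (F.binomial φ P) =
      monomial (squarefreeExponent P) 1 := by
  obtain ⟨ε, hε, hgap⟩ := hψ.exists_gap
  rw [binomial, prod_X_eq_monomial]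
  exact BatyrevQuantum.initialForm_binomial (by linarith [hgap P hP]) _

variable {F} in
theorem IsStrictlyConvexSupport.initialForm_mem {ψ : F.PL ℝ} (hψ : F.IsStrictlyConvexSupport ψ)
    {φ : F.PL ℂ} {f : MvPolynomial F.Gen ℂ} (hf : f ∈ F.quantumIdeal φ) :
    initialForm (fun v : F.Gen => (ψ : E → ℝ) v) f ∈ F.stanleyReisner := by
  classical
  rw [mem_stanleyReisner_iff]
  intro a ha
  rw [mem_support_iff, coeff_initialForm] at ha
  have hmax := (ite_ne_right_iff.1 ha).1
  have hc := (ite_ne_right_iff.1 ha).2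
  by_cases hs : F.Spans a.support
  · refine absurd (F.degreeSum_eq_zero hf (Finsupp.weight (fun v : F.Gen => (v : E)) a)) ?_
    rw [← support_sum_monomial_coeff f, map_sum, Finset.sum_eq_single a]
    · rw [degreeSum_monomial, if_pos rfl]
      exact mul_ne_zero hc (Complex.exp_ne_zero _)
    · intro b hb hba
      rw [degreeSum_monomial, if_neg]
      intro hw
      -- Another term of the same degree is nonstandard, hence heavier than `a`, against maximality.
      -- So `a` alone contributes to `degreeSum`.
      have hbs : ¬ F.Spans b.support := fun hbs => hba (F.eq_of_weight_eq hbs hs hw)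
      have h1 := hψ.map_weight_lt hbs
      rw [hw, F.map_weight ψ hs] at h1
      exact (hmax b hb).not_gt h1
    · intro h
      exact absurd (mem_support_iff.2 hc) h
  · obtain ⟨P, hPa, hP⟩ := F.exists_isPrimitiveCollection_subset hs
    exact ⟨P, hP, squarefreeExponent_le_iff.2 hPa⟩

variable {F} in
theorem IsStrictlyConvexSupport.span_initialForm {ψ : F.PL ℝ} (hψ : F.IsStrictlyConvexSupport ψ)
    (φ : F.PL ℂ) :
    Ideal.span (initialForm (fun v : F.Gen => (ψ : E → ℝ) v) '' F.primitiveBinomials φ) =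
      F.stanleyReisner := by
  rw [stanleyReisner, primitiveBinomials, Set.image_image]
  congr 1
  refine Set.image_congr fun P hP => ?_
  rw [hψ.initialForm_binomial φ hP, prod_X_eq_monomial]

variable {F} in
theorem IsStrictlyConvexSupport.initialIdeal_eq {ψ : F.PL ℝ} (hψ : F.IsStrictlyConvexSupport ψ)
    (φ : F.PL ℂ) :
    initialIdeal (fun v : F.Gen => (ψ : E → ℝ) v) (F.quantumIdeal φ) = F.stanleyReisner := by
  refine le_antisymm (Ideal.span_le.2 ?_) ?_
  · rintro _ ⟨f, hf, rfl⟩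
    exact hψ.initialForm_mem hf
  · rw [← hψ.span_initialForm φ]
    refine Ideal.span_mono (Set.image_mono ?_)
    rintro _ ⟨P, _, rfl⟩
    exact F.binomial_mem_quantumIdeal φ P

theorem support_binomial_subset (φ : F.PL ℂ) (P : Finset F.Gen) {m : F.Gen →₀ ℕ}
    (hm : m ∈ (F.binomial φ P).support) : m = squarefreeExponent P ∨ m = F.primitiveExponent P := by
  classical
  by_contra! h
  rw [binomial, prod_X_eq_monomial, mem_support_iff, coeff_sub, coeff_monomial, coeff_monomial,
    if_neg h.1.symm, if_neg h.2.symm, sub_zero] at hm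
  exact hm rfl

variable {F} in
theorem IsStrictlyConvexSupport.isReducedGroebnerBasis {ψ : F.PL ℝ}
    (hψ : F.IsStrictlyConvexSupport ψ) (φ : F.PL ℂ) :
    IsReducedGroebnerBasis (fun v : F.Gen => (ψ : E → ℝ) v) (F.quantumIdeal φ)
      (F.primitiveBinomials φ) := by
  refine ⟨⟨?_, by rw [hψ.span_initialForm, hψ.initialIdeal_eq]⟩, ?_⟩
  · rintro _ ⟨P, _, rfl⟩
    exact F.binomial_mem_quantumIdeal φ P
  · rintro _ ⟨P, hP, rfl⟩
    refine ⟨squarefreeExponent P, hψ.initialForm_binomial φ hP, ?_⟩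
    rintro _ ⟨Q, hQ, rfl⟩ m hm hPm
    rw [squarefreeExponent_le_iff] at hPm
    rcases F.support_binomial_subset φ Q hm with rfl | rfl
    · rw [support_squarefreeExponent] at hPm
      -- Primitive collections are pairwise incomparable under inclusion.
      obtain rfl | hlt := hPm.eq_or_ssubset
      · exact ⟨rfl, rfl⟩
      · exact absurd (hQ.2 P hlt) hP.1
    -- The second term of a binomial is standard, so its support cannot contain a primitive
    -- collection.
    · exact absurd ((F.primitiveExponent_spans Q).mono hPm) hP.1

end CompleteRegularFan

end BatyrevQuantum

theorem mainTheorem1 {E : Type*} [NormedAddCommGroup E] [NormedSpace ℝ E] [FiniteDimensional ℝ E]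
    (L : Submodule ℤ E) [DiscreteTopology L] [IsZLattice ℝ L]
    (F : BatyrevQuantum.CompleteRegularFan L)
    (hK : (interior F.kahlerCone).Nonempty)
    (φ : F.PL ℂ) :
    {P | F.IsPrimitiveCollection P}.Finite ∧
    F.quantumIdeal φ = Ideal.span (F.primitiveBinomials φ) ∧
    (∃ ψ : F.PL ℝ, F.IsStrictlyConvexSupport ψ) ∧
    ∀ ψ : F.PL ℝ, F.IsStrictlyConvexSupport ψ →
      BatyrevQuantum.IsReducedGroebnerBasis (fun v : F.Gen => (ψ : E → ℝ) v)
        (F.quantumIdeal φ) (F.primitiveBinomials φ) ∧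
      BatyrevQuantum.initialIdeal (fun v : F.Gen => (ψ : E → ℝ) v) (F.quantumIdeal φ) =
        F.stanleyReisner := by
  obtain ⟨ψ₀, hψ₀⟩ := F.exists_isStrictlyConvexSupport hK
  exact ⟨F.finite_primitiveCollections, hψ₀.quantumIdeal_eq_span φ, ⟨ψ₀, hψ₀⟩,
    fun ψ hψ => ⟨hψ.isReducedGroebnerBasis φ, hψ.initialIdeal_eq φ⟩⟩
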